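/- Let $B>1$ be an integer, and let $G=\sum_{n=0}^{\infty}\frac{(-1)^n}{(2n+1)^2}$ be Catalan's constant. For an integer $k\ge 1$ let $L_B(k)$ be the number of digits of $k$ in base $B$, and put $L_B(0)=0$. Let $$P_B(x)=(Bx+1)(Bx+2)\cdots(Bx+B-1)\sum_{m=1}^{B-1}\frac{m(B-m)}{Bx+m}.$$ Define the sequence $(c_n)_{n\ge 0}$ by $c_0=0$ and $$c_{2k}=c_{\lfloor 2k/B\rfloor}+k\quad(k\ge 1),\qquad c_{2k+1}=c_{\lfloor (2k+1)/B\rfloor}+\frac{(-1)^{k-1}-1}{2}(2k+1)\quad(k\ge 0).$$ Then $$\frac{G}{\pi}=\frac{11}{32}+\sum_{k=1}^{\infty}\left(\frac18 L_B\Bigl(\Bigl\lfloor\frac k2\Bigr\rfloor\Bigr)-\frac18 L_B(k)+c_k\right)\frac{P_B(k)}{Bk(Bk+1)\cdots(Bk+B)},$$ where the series converges absolutely. -/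

import Mathlib

/-- Catalan's constant `G = 1 - 1/3² + 1/5² - 1/7² + ⋯` (an absolutely convergent series). -/
noncomputable def catalanConstant : ℝ :=
  ∑' n : ℕ, (-1 : ℝ) ^ n / (2 * (n : ℝ) + 1) ^ 2

/-- The `B`-ary length `L_B(k)` of `k`: the number of digits in its shortest base-`B` expansion.
The expansion of `0` is the empty word, so `L_B(0) = 0`. -/
def baseLength (B k : ℕ) : ℕ :=
  (Nat.digits B k).length

/-- `P_B(x) = (Bx+1)(Bx+2)⋯(Bx+B-1) ∑_{m=1}^{B-1} m(B-m)/(Bx+m)`. The denominators do not vanish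
for `x ≥ 0`, where this is the value at `x` of a polynomial of degree `B - 2`. -/
noncomputable def addisonP (B : ℕ) (x : ℝ) : ℝ :=
  (∏ j ∈ Finset.Icc 1 (B - 1), ((B : ℝ) * x + (j : ℝ))) *
    ∑ m ∈ Finset.Icc 1 (B - 1), (m : ℝ) * ((B : ℝ) - (m : ℝ)) / ((B : ℝ) * x + (m : ℝ))

/-- The product `Bx(Bx+1)⋯(Bx+B)`. -/
noncomputable def addisonDenom (B : ℕ) (x : ℝ) : ℝ :=
  ∏ j ∈ Finset.range (B + 1), ((B : ℝ) * x + (j : ℝ))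

/-- The sequence `c_n` for the base `B > 1`: `c_0 = 0`, and for `n ≥ 1`,
`c_n = c_{⌊n/B⌋} + k` if `n = 2k`, and
`c_n = c_{⌊n/B⌋} + (((-1)^(k-1) - 1)/2) (2k+1)` if `n = 2k+1`.
The exponent `k - 1` is an integer (it is `-1` for `k = 0`). -/
noncomputable def catalanSeq (B : ℕ) (hB : 1 < B) (n : ℕ) : ℝ :=
  if hn : n = 0 then 0
  else
    catalanSeq B hB (n / B) +
      if Even n then ((n / 2 : ℕ) : ℝ)
      else ((-1 : ℝ) ^ (((n / 2 : ℕ) : ℤ) - 1) - 1) / 2 * (2 * ((n / 2 : ℕ) : ℝ) + 1)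
termination_by n
decreasing_by exact Nat.div_lt_self (Nat.pos_of_ne_zero hn) hB

theorem catalanSeq_zero (B : ℕ) (hB : 1 < B) : catalanSeq B hB 0 = 0 := by
  rw [catalanSeq]; simp

theorem catalanSeq_even (B : ℕ) (hB : 1 < B) (k : ℕ) (hk : 1 ≤ k) :
    catalanSeq B hB (2 * k) = catalanSeq B hB (2 * k / B) + (k : ℝ) := by
  rw [catalanSeq, dif_neg (by omega), if_pos (even_two_mul k), Nat.mul_div_cancel_left k two_pos]

theorem catalanSeq_odd (B : ℕ) (hB : 1 < B) (k : ℕ) :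
    catalanSeq B hB (2 * k + 1) = catalanSeq B hB ((2 * k + 1) / B) +
      ((-1 : ℝ) ^ ((k : ℤ) - 1) - 1) / 2 * (2 * (k : ℝ) + 1) := by
  have h : (2 * k + 1) / 2 = k := by omega
  rw [catalanSeq, dif_neg (by omega), if_neg (by simp [Nat.even_add_one]), h]

/-! Write τ(n) for `trapezoidError n`. Refining the trapezoidal rule on [Bk, Bk+B] from one step to
B unit steps gives P_B(k)/(Bk⋯(Bk+B)) = τ(k) − Σ_{i<B} τ(Bk+i) (`addison_ratio_eq`). If a_0 = 0 and
a_n = O(n), then since τ(n) = O(n⁻³) the series Σ a_k P_B(k)/(Bk⋯(Bk+B)) can be regrouped as Σ (a_n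
− a_{⌊n/B⌋}) τ(n). For the coefficients here this difference is free of B: it is `catalanIncrement
n`, less 1/8 at n = 1 (`catalanCoeff_sub`).

There remains one base-free sum, `hasSum_catalanIncrement`. Its source is G = (π/2)∫_0^{1/2}
πx/sin(πx) dx. Integrating the partial fractions of the cotangent termwise expresses G/π through
logarithms of ratios of consecutive odd integers; splitting these logarithms produces the τ(n).
Stirling's formula and harmonic numbers evaluate the elementary leftovers. -/

/-! ### Integral representations of Catalan's constant -/

open MeasureTheory Set in
theorem integral_Ioo_pow (n : ℕ) : ∫ x in Ioo (0 : ℝ) 1, x ^ n = 1 / ((n : ℝ) + 1) := by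
  rw [← integral_Ioc_eq_integral_Ioo, ← intervalIntegral.integral_of_le zero_le_one, integral_pow]
  simp

theorem summable_inv_two_mul_add_one_sq :
    Summable (fun n : ℕ => 1 / (2 * (n : ℝ) + 1) ^ 2) := by
  have h := (Real.summable_one_div_nat_pow (p := 2)).2 (by norm_num)
  have h2 := h.comp_injective (i := fun n : ℕ => 2 * n + 1) (fun a b hab => by simpa using hab)
  refine h2.congr fun n => ?_
  simp

open MeasureTheory Set in
theorem catalanConstant_eq_integral_arctan :
    catalanConstant = ∫ x in Ioo (0 : ℝ) 1, Real.arctan x / x := by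
  have hint : ∀ n : ℕ, Integrable (fun x : ℝ => (-1 : ℝ) ^ n * x ^ (2 * n) / (2 * (n : ℝ) + 1))
      (volume.restrict (Ioo (0 : ℝ) 1)) := fun n =>
    ((by fun_prop : Continuous fun x : ℝ => (-1 : ℝ) ^ n * x ^ (2 * n) / (2 * (n : ℝ) + 1)
      ).integrableOn_Icc (a := 0) (b := 1)).mono_set Ioo_subset_Icc_self
  have hnorm : ∀ n : ℕ, ∫ x in Ioo (0 : ℝ) 1, ‖(-1 : ℝ) ^ n * x ^ (2 * n) / (2 * (n : ℝ) + 1)‖ =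
      1 / (2 * (n : ℝ) + 1) ^ 2 := by
    intro n
    have hn : (0 : ℝ) < 2 * (n : ℝ) + 1 := by positivity
    have : ∀ x : ℝ, ‖(-1 : ℝ) ^ n * x ^ (2 * n) / (2 * (n : ℝ) + 1)‖ =
        x ^ (2 * n) / (2 * (n : ℝ) + 1) := by
      intro x
      rw [norm_div, norm_mul, norm_pow, norm_neg, norm_one, one_pow, one_mul, Real.norm_of_nonneg
        hn.le, Real.norm_of_nonneg (by rw [pow_mul]; positivity)]
    simp_rw [this]
    rw [integral_div, integral_Ioo_pow]
    push_cast
    field_simp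
  have hval : ∀ n : ℕ, ∫ x in Ioo (0 : ℝ) 1, (-1 : ℝ) ^ n * x ^ (2 * n) / (2 * (n : ℝ) + 1) =
      (-1 : ℝ) ^ n / (2 * (n : ℝ) + 1) ^ 2 := by
    intro n
    rw [integral_div, integral_const_mul, integral_Ioo_pow]
    push_cast
    field_simp
  have h := hasSum_integral_of_summable_integral_norm hint
    (by simp_rw [hnorm]; exact summable_inv_two_mul_add_one_sq)
  simp_rw [hval] at h
  rw [catalanConstant, h.tsum_eq]
  refine setIntegral_congr_fun measurableSet_Ioo fun x hx => ?_
  have hx' : ‖x‖ < 1 := by rw [Real.norm_of_nonneg hx.1.le]; exact hx.2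
  have h2 := (Real.hasSum_arctan hx').div_const x
  have hx0 : x ≠ 0 := hx.1.ne'
  refine (h2.congr_fun fun n => ?_).tsum_eq
  push_cast
  field_simp
  ring

-- Substitute y = tan(πx/2) in ∫ arctan(y)/y dy and use the double-angle formula for the sine.
open MeasureTheory Set Real in
theorem catalanConstant_eq_integral_sin :
    catalanConstant = π / 2 * ∫ x in Ioo (0 : ℝ) (1 / 2), π * x / sin (π * x) := by
  have hpi := pi_pos
  have himg : (fun x : ℝ => tan (π * x / 2)) '' Ioo 0 (1 / 2) = Ioo 0 1 := by
    ext y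
    constructor
    · rintro ⟨x, ⟨h0, h1⟩, rfl⟩
      have hx : π * x / 2 < π / 4 := by nlinarith
      have hx0 : 0 < π * x / 2 := by positivity
      refine ⟨tan_pos_of_pos_of_lt_pi_div_two hx0 (by linarith), ?_⟩
      rw [← tan_pi_div_four]
      exact tan_lt_tan_of_lt_of_lt_pi_div_two (by linarith) (by linarith) hx
    · rintro ⟨h0, h1⟩
      refine ⟨2 / π * arctan y, ⟨by have := arctan_pos.2 h0; positivity, ?_⟩, ?_⟩
      · have : arctan y < π / 4 := by rw [← arctan_one]; exact arctan_strictMono h1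
        rw [div_mul_eq_mul_div, div_lt_iff₀ hpi]
        linarith
      · have : π * (2 / π * arctan y) / 2 = arctan y := by field_simp
        simp only [this, tan_arctan]
  have hinj : InjOn (fun x : ℝ => tan (π * x / 2)) (Ioo 0 (1 / 2)) := by
    intro a ha b hb hab
    have h : π * a / 2 = π * b / 2 := injOn_tan
      ⟨by nlinarith [mul_pos hpi ha.1], by nlinarith [ha.2]⟩
      ⟨by nlinarith [mul_pos hpi hb.1], by nlinarith [hb.2]⟩ hab
    have h2 : π * a = π * b := by linarith
    exact mul_left_cancel₀ hpi.ne' h2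
  have hcos : ∀ x ∈ Ioo (0 : ℝ) (1 / 2), 0 < cos (π * x / 2) := fun x hx =>
    cos_pos_of_mem_Ioo ⟨by nlinarith [mul_pos hpi hx.1], by nlinarith [hx.2]⟩
  have hsin : ∀ x ∈ Ioo (0 : ℝ) (1 / 2), 0 < sin (π * x / 2) := fun x hx =>
    sin_pos_of_pos_of_lt_pi (by nlinarith [mul_pos hpi hx.1]) (by nlinarith [hx.2])
  have hder : ∀ x ∈ Ioo (0 : ℝ) (1 / 2), HasDerivWithinAt (fun x : ℝ => tan (π * x / 2))
      (1 / cos (π * x / 2) ^ 2 * (π / 2)) (Ioo 0 (1 / 2)) x := by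
    intro x hx
    have h1 : HasDerivAt (fun x : ℝ => π * x / 2) (π / 2) x := by
      simpa using ((hasDerivAt_id x).const_mul π).div_const 2
    exact ((hasDerivAt_tan (hcos x hx).ne').comp x h1).hasDerivWithinAt
  rw [catalanConstant_eq_integral_arctan, ← himg,
    integral_image_eq_integral_abs_deriv_smul measurableSet_Ioo hder hinj, ← integral_const_mul]
  refine setIntegral_congr_fun measurableSet_Ioo fun x hx => ?_
  have hc := hcos x hx
  have hs := hsin x hx
  simp only [smul_eq_mul]
  rw [abs_of_pos (by positivity), arctan_tan (by nlinarith [mul_pos hpi hx.1])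
    (by nlinarith [hx.2]), show π * x = 2 * (π * x / 2) by ring, sin_two_mul, tan_eq_sin_div_cos]
  rw [show 2 * (π * x / 2) / 2 = π * x / 2 by ring]
  field_simp

/-! ### Termwise integration of the cotangent series -/

/-- The integral over `[0, 1/2]` of the `n`-th term of the partial fraction series of
`π x cot (π x)`. -/
noncomputable def cotIntegral (n : ℕ) : ℝ :=
  1 - n * Real.log ((2 * n + 1) / (2 * n - 1))

theorem cot_term_norm_le {n : ℕ} (hn : 1 ≤ n) {x : ℝ} (hx : x ∈ Set.Icc (0 : ℝ) (1 / 2)) :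
    |2 * x ^ 2 / (x ^ 2 - (n : ℝ) ^ 2)| ≤ 1 / (n : ℝ) ^ 2 := by
  have h1 : (1 : ℝ) ≤ n := by exact_mod_cast hn
  obtain ⟨h0, h2⟩ := hx
  have h3 : x ^ 2 ≤ 1 / 4 := by nlinarith
  have h4 : (1 : ℝ) ≤ (n : ℝ) ^ 2 := by nlinarith
  rw [abs_div, abs_of_nonneg (by positivity), abs_of_neg (by linarith), div_le_div_iff₀
    (by linarith) (by positivity)]
  nlinarith

theorem cot_term_continuousOn {n : ℕ} (hn : 1 ≤ n) :
    ContinuousOn (fun x : ℝ => 2 * x ^ 2 / (x ^ 2 - (n : ℝ) ^ 2)) (Set.Icc (0 : ℝ) (1 / 2)) := by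
  have h1 : (1 : ℝ) ≤ n := by exact_mod_cast hn
  refine ContinuousOn.div (by fun_prop) (by fun_prop) fun x hx => ?_
  obtain ⟨h0, h2⟩ := hx
  nlinarith

open MeasureTheory Set in
theorem integral_cot_term {n : ℕ} (hn : 1 ≤ n) :
    ∫ x in (0 : ℝ)..(1 / 2), 2 * x ^ 2 / (x ^ 2 - (n : ℝ) ^ 2) = cotIntegral n := by
  have h1 : (1 : ℝ) ≤ n := by exact_mod_cast hn
  have hu : uIcc (0 : ℝ) (1 / 2) = Icc 0 (1 / 2) := uIcc_of_le (by norm_num)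
  rw [intervalIntegral.integral_eq_sub_of_hasDerivAt
    (f := fun x : ℝ => 2 * x + n * (Real.log (n - x) - Real.log (n + x)))]
  · rw [cotIntegral, Real.log_div (by linarith) (by linarith),
      show (n : ℝ) - 1 / 2 = (2 * n - 1) / 2 by ring, show (n : ℝ) + 1 / 2 = (2 * n + 1) / 2 by ring,
      Real.log_div (by linarith) (by norm_num), Real.log_div (by linarith) (by norm_num)]
    simp
    ring
  · intro x hx
    rw [hu] at hx
    obtain ⟨h0, h2⟩ := hx
    have hp : (n : ℝ) + x ≠ 0 := by linarith
    have hm : (n : ℝ) - x ≠ 0 := by linarith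
    have hd : x ^ 2 - (n : ℝ) ^ 2 ≠ 0 := by nlinarith
    have e1 := (((hasDerivAt_id x).const_sub (n : ℝ)).log hm)
    have e2 := (((hasDerivAt_id x).const_add (n : ℝ)).log hp)
    convert! ((hasDerivAt_id x).const_mul 2).add ((e1.sub e2).const_mul (n : ℝ)) using 1
    simp only [id]
    field_simp
    ring
  · rw [intervalIntegrable_iff, uIoc_of_le (by norm_num)]
    exact ((cot_term_continuousOn hn).integrableOn_Icc).mono_set Ioc_subset_Icc_self

open Real in
theorem hasSum_pi_mul_cot {x : ℝ} (h0 : 0 < x) (h1 : x < 1) :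
    HasSum (fun n : ℕ => 2 * x ^ 2 / (x ^ 2 - ((n + 1 : ℕ) : ℝ) ^ 2)) (π * x * cot (π * x) - 1) := by
  have hmem : (x : ℂ) ∈ Complex.integerComplement := by
    rintro ⟨k, hk⟩
    have hk' : (k : ℝ) = x := by exact_mod_cast hk
    rw [← hk'] at h0 h1
    have a : (0 : ℤ) < k := by exact_mod_cast h0
    have b : k < (1 : ℤ) := by exact_mod_cast h1
    omega
  have h := ((summable_cotTerm hmem).hasSum)
  simp only [cotTerm] at h
  rw [← cot_series_rep' hmem] at h
  have h' : HasSum (fun n : ℕ => 1 / (x - (n + 1)) + 1 / (x + (n + 1))) (π * cot (π * x) - 1 / x) := by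
    rw [← Complex.hasSum_ofReal]
    push_cast
    exact h
  have h2 := h'.mul_left x
  have e : x * (π * cot (π * x) - 1 / x) = π * x * cot (π * x) - 1 := by field_simp
  rw [e] at h2
  refine h2.congr_fun fun n => ?_
  have : (0 : ℝ) ≤ n := n.cast_nonneg
  have a1 : x - (n + 1) ≠ 0 := by linarith
  have a2 : x + (n + 1) ≠ 0 := by linarith
  have a3 : x ^ 2 - ((n : ℝ) + 1) ^ 2 ≠ 0 := by
    rw [sq_sub_sq]
    exact mul_ne_zero a2 a1
  push_cast
  field_simp
  ring

-- Since 1/sin 2θ = cot θ − cot 2θ, πx/sin(πx) is twice πx/2 · cot(πx/2) minus πx cot(πx). Halving x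
-- turns the n-th pole into the 2n-th, which explains the index 2(n+1). The −1/2 is the integral of
-- the constant term.
open MeasureTheory Set Real in
theorem hasSum_catalanConstant_cotIntegral :
    HasSum (fun n : ℕ => 2 * cotIntegral (2 * (n + 1)) - cotIntegral (n + 1))
      (2 * catalanConstant / π - 1 / 2) := by
  have hpi := pi_pos
  have hu : uIoc (0 : ℝ) (1 / 2) = Ioc 0 (1 / 2) := uIoc_of_le (by norm_num)
  have hsub : Ioc (0 : ℝ) (1 / 2) ⊆ Icc 0 (1 / 2) := Ioc_subset_Icc_self
  have hint : ∀ n : ℕ, 1 ≤ n → IntervalIntegrable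
      (fun x : ℝ => 2 * x ^ 2 / (x ^ 2 - (n : ℝ) ^ 2)) volume 0 (1 / 2) := by
    intro n hn
    rw [intervalIntegrable_iff, hu]
    exact ((cot_term_continuousOn hn).integrableOn_Icc).mono_set hsub
  have hval : ∀ n : ℕ, ∫ x in (0 : ℝ)..(1 / 2), (2 * (2 * x ^ 2 / (x ^ 2 - ((2 * (n + 1) : ℕ) : ℝ) ^ 2))
      - 2 * x ^ 2 / (x ^ 2 - ((n + 1 : ℕ) : ℝ) ^ 2)) =
      2 * cotIntegral (2 * (n + 1)) - cotIntegral (n + 1) := by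
    intro n
    rw [intervalIntegral.integral_sub ((hint _ (by omega)).const_mul 2) (hint _ (by omega)),
      intervalIntegral.integral_const_mul, integral_cot_term (by omega), integral_cot_term (by omega)]
  have hs : Summable fun n : ℕ => 3 / ((n + 1 : ℕ) : ℝ) ^ 2 := by
    have h := (Real.summable_one_div_nat_pow (p := 2)).2 (by norm_num)
    have h2 := ((summable_nat_add_iff 1).2 h).mul_left 3
    exact h2.congr fun n => by ring
  have h := intervalIntegral.hasSum_integral_of_dominated_convergence (μ := volume)
    (a := (0 : ℝ)) (b := 1 / 2)
    (F := fun (n : ℕ) (x : ℝ) => 2 * (2 * x ^ 2 / (x ^ 2 - ((2 * (n + 1) : ℕ) : ℝ) ^ 2))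
      - 2 * x ^ 2 / (x ^ 2 - ((n + 1 : ℕ) : ℝ) ^ 2))
    (f := fun x => π * x / sin (π * x) - 1) (fun n _ => 3 / ((n + 1 : ℕ) : ℝ) ^ 2)
    (fun n => by
      have := (((hint (2 * (n + 1)) (by omega)).const_mul 2).sub (hint (n + 1) (by omega)))
      exact (intervalIntegrable_iff.1 this).aestronglyMeasurable)
    (fun n => Filter.Eventually.of_forall fun x hx => by
      rw [hu] at hx
      have b1 := cot_term_norm_le (n := 2 * (n + 1)) (by omega) (hsub hx)
      have b2 := cot_term_norm_le (n := n + 1) (by omega) (hsub hx)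
      have b3 : 1 / ((2 * (n + 1) : ℕ) : ℝ) ^ 2 ≤ 1 / ((n + 1 : ℕ) : ℝ) ^ 2 := by
        apply one_div_le_one_div_of_le (by positivity)
        gcongr
        omega
      have b4 : 3 / ((n + 1 : ℕ) : ℝ) ^ 2 = 3 * (1 / ((n + 1 : ℕ) : ℝ) ^ 2) := by ring
      rw [b4]
      refine (norm_sub_le _ _).trans ?_
      rw [norm_mul, Real.norm_eq_abs, Real.norm_eq_abs, Real.norm_eq_abs, abs_two]
      linarith)
    (Filter.Eventually.of_forall fun x _ => hs)
    intervalIntegrable_const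
    (Filter.Eventually.of_forall fun x hx => by
      rw [hu] at hx
      obtain ⟨h0, h1⟩ := hx
      have k1 := hasSum_pi_mul_cot (x := x / 2) (by linarith) (by linarith)
      have k2 := hasSum_pi_mul_cot (x := x) (by linarith) (by linarith)
      have hsin : 0 < sin (π * (x / 2)) :=
        sin_pos_of_pos_of_lt_pi (by positivity) (by nlinarith)
      have hcos : 0 < cos (π * (x / 2)) :=
        cos_pos_of_mem_Ioo ⟨by nlinarith [mul_pos hpi h0], by nlinarith⟩
      have hv : 2 * (π * (x / 2) * cot (π * (x / 2)) - 1) - (π * x * cot (π * x) - 1) =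
          π * x / sin (π * x) - 1 := by
        rw [show cot (π * x) = cos (π * x) / sin (π * x) from cot_eq_cos_div_sin _,
          cot_eq_cos_div_sin, show π * x = 2 * (π * (x / 2)) by ring, sin_two_mul, cos_two_mul]
        generalize cos (π * (x / 2)) = c at hcos ⊢
        generalize sin (π * (x / 2)) = s at hsin ⊢
        field_simp
        ring
      rw [← hv]
      refine ((k1.mul_left 2).sub k2).congr_fun fun n => ?_
      have a3 : x ^ 2 - ((n : ℝ) + 1) ^ 2 * 4 ≠ 0 := by
        have : (0 : ℝ) ≤ n := n.cast_nonneg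
        nlinarith
      push_cast
      rw [show (x / 2) ^ 2 - ((n : ℝ) + 1) ^ 2 = (x ^ 2 - ((n : ℝ) + 1) ^ 2 * 4) / 4 by ring,
        show x ^ 2 - (2 * ((n : ℝ) + 1)) ^ 2 = x ^ 2 - ((n : ℝ) + 1) ^ 2 * 4 by ring]
      field_simp
      ring)
  simp_rw [hval] at h
  -- Jordan's inequality bounds the integrand by π/2.
  have hI : IntervalIntegrable (fun x : ℝ => π * x / sin (π * x)) volume 0 (1 / 2) := by
    rw [intervalIntegrable_iff, hu]
    refine Measure.integrableOn_of_bounded (M := π / 2) (by simp)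
      (Measurable.aestronglyMeasurable (by fun_prop)) ?_
    refine (ae_restrict_iff' measurableSet_Ioc).2 (Filter.Eventually.of_forall fun x hx => ?_)
    obtain ⟨h0, h1⟩ := hx
    have hs : 0 < sin (π * x) := sin_pos_of_pos_of_lt_pi (by positivity) (by nlinarith)
    have hj := mul_le_sin (x := π * x) (by positivity) (by nlinarith)
    rw [Real.norm_of_nonneg (by positivity), div_le_iff₀ hs]
    have hm := mul_le_mul_of_nonneg_left hj (by positivity : (0 : ℝ) ≤ π / 2)
    calc π * x = π / 2 * (2 / π * (π * x)) := by field_simp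
      _ ≤ _ := hm
  rw [intervalIntegral.integral_sub hI intervalIntegrable_const,
    intervalIntegral.integral_of_le (by norm_num), integral_Ioc_eq_integral_Ioo] at h
  have e : ∫ x in Ioo (0 : ℝ) (1 / 2), π * x / sin (π * x) = 2 * catalanConstant / π := by
    rw [catalanConstant_eq_integral_sin]
    field_simp
  rw [e] at h
  simpa using h

/-! ### Elementary limits from Stirling and harmonic numbers -/

open Filter Topology Real in
-- Summation by parts leaves log(1·3⋯(2M−1)), and this product is (2M)!/(2^M M!).
theorem sum_cotIntegral (M : ℕ) : ∑ n ∈ Finset.range M, cotIntegral (n + 1) =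
    M + log (2 * M).factorial - M * log 2 - log M.factorial - M * log (2 * M + 1) := by
  induction M with
  | zero => simp
  | succ M ih =>
    have hM : (0 : ℝ) ≤ M := M.cast_nonneg
    have h1 : ((M.factorial : ℕ) : ℝ) ≠ 0 := by exact_mod_cast M.factorial_ne_zero
    have h2 : (((2 * M).factorial : ℕ) : ℝ) ≠ 0 := by exact_mod_cast (2 * M).factorial_ne_zero
    rw [Finset.sum_range_succ, ih, cotIntegral, show 2 * (M + 1) = 2 * M + 1 + 1 by ring,
      Nat.factorial_succ, Nat.factorial_succ, Nat.factorial_succ]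
    push_cast
    rw [show (2 * ((M : ℝ) + 1) - 1) = 2 * M + 1 by ring,
      show 2 * (M : ℝ) + 1 + 1 = 2 * (M + 1) by ring,
      log_div (by positivity) (by positivity), log_mul (by positivity) (by positivity),
      log_mul (by positivity) h2, log_mul (by norm_num) (by positivity),
      log_mul (by positivity) h1]
    ring

open Filter Topology Real in
theorem tendsto_sum_cotIntegral :
    Tendsto (fun M : ℕ => ∑ n ∈ Finset.range M, cotIntegral (n + 1)) atTop
      (𝓝 (1 / 2 * log 2 - 1 / 2)) := by
  have hs : Tendsto (fun n : ℕ => log (Stirling.stirlingSeq n)) atTop (𝓝 (log √π)) :=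
    Stirling.tendsto_stirlingSeq_sqrt_pi.log (by positivity)
  have h2 : Tendsto (fun n : ℕ => 2 * n) atTop atTop :=
    tendsto_atTop_mono (fun n => (by omega : n ≤ 2 * n)) tendsto_id
  -- This is M log((2M+1)/(2M)), the part of the sum not absorbed by the Stirling sequence.
  have hl : Tendsto (fun M : ℕ => 1 / 2 * ((2 * M : ℕ) * log (1 + 1 / (2 * M : ℕ)))) atTop
      (𝓝 (1 / 2 * 1)) :=
    (((tendsto_mul_log_one_add_div_atTop 1).comp tendsto_natCast_atTop_atTop).comp h2).const_mul _
  have h := (((hs.comp h2).sub hs).add_const (1 / 2 * log 2)).sub hl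
  rw [sub_self, zero_add, mul_one] at h
  refine h.congr' ?_
  filter_upwards [eventually_ge_atTop 1] with M hM
  have hM' : (0 : ℝ) < M := by exact_mod_cast hM
  rw [sum_cotIntegral]
  simp only [Function.comp, Stirling.log_stirlingSeq_formula]
  push_cast
  rw [show (1 : ℝ) + 1 / (2 * M) = (2 * M + 1) / (2 * M) by field_simp,
    log_div (by positivity) (by positivity), log_div (by positivity) (by positivity),
    log_div (by positivity) (by positivity), log_exp,
    log_mul (by norm_num) (by positivity), log_mul (by norm_num) (by positivity)]
  ring

theorem sum_odd_reciprocals (K : ℕ) :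
    ∑ k ∈ Finset.range K, (2 / (4 * (k : ℝ) + 4) - 1 / (4 * (k : ℝ) + 3) - 1 / (4 * (k : ℝ) + 5)) =
      1 - 1 / (4 * (K : ℝ) + 1) - (harmonic (4 * K) : ℝ) + 1 / 2 * (harmonic (2 * K) : ℝ) +
        1 / 2 * (harmonic K : ℝ) := by
  induction K with
  | zero => simp
  | succ K ih =>
    rw [Finset.sum_range_succ, ih, show 4 * (K + 1) = 4 * K + 1 + 1 + 1 + 1 by ring,
      show 2 * (K + 1) = 2 * K + 1 + 1 by ring]
    simp only [harmonic_succ]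
    push_cast
    field_simp
    ring

open Filter Topology Real in
theorem tendsto_sum_odd_reciprocals :
    Tendsto (fun K : ℕ => ∑ k ∈ Finset.range K,
      (2 / (4 * (k : ℝ) + 4) - 1 / (4 * (k : ℝ) + 3) - 1 / (4 * (k : ℝ) + 5))) atTop
      (𝓝 (1 - 3 / 2 * log 2)) := by
  have hc : ∀ c : ℕ, 0 < c → Tendsto (fun n : ℕ => c * n) atTop atTop := fun c hc =>
    tendsto_atTop_mono (fun n => Nat.le_mul_of_pos_left n hc) tendsto_id
  have h0 := tendsto_harmonic_sub_log
  have h4 := h0.comp (hc 4 (by norm_num))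
  have h2 := h0.comp (hc 2 (by norm_num))
  have hz : Tendsto (fun K : ℕ => 1 / (((4 * K : ℕ) : ℝ) + 1)) atTop (𝓝 0) :=
    tendsto_one_div_add_atTop_nhds_zero_nat.comp (hc 4 (by norm_num))
  have h := ((((hz.const_sub (1 - 3 / 2 * log 2)).sub h4).add (h2.const_mul (1 / 2))).add
    (h0.const_mul (1 / 2)))
  rw [show 1 - 3 / 2 * log 2 - 0 - eulerMascheroniConstant + 1 / 2 * eulerMascheroniConstant +
    1 / 2 * eulerMascheroniConstant = 1 - 3 / 2 * log 2 by ring] at h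
  refine h.congr' ?_
  filter_upwards [eventually_ge_atTop 1] with K hK
  have hK' : (0 : ℝ) < K := by exact_mod_cast hK
  rw [sum_odd_reciprocals]
  simp only [Function.comp]
  push_cast
  rw [show (4 : ℝ) * K = 2 * (2 * K) by ring, log_mul (by norm_num) (by positivity),
    log_mul (by norm_num) (by positivity)]
  ring

/-! ### Decay and subdivision of trapezoidal errors -/

/-- The error of the trapezoidal rule for `∫ 1/x` on `[n, n + 1]`. -/
noncomputable def trapezoidError (n : ℕ) : ℝ :=
  1 / 2 * (1 / (n : ℝ) + 1 / ((n : ℝ) + 1)) - Real.log (((n : ℝ) + 1) / n)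

/-- With t = 1/n, the trapezoidal value and log(1+t) agree through order t². -/
theorem abs_trapezoidError_le {n : ℕ} (hn : 2 ≤ n) :
    |trapezoidError n| ≤ 3 / (n : ℝ) ^ 3 := by
  have hn' : (2 : ℝ) ≤ n := by exact_mod_cast hn
  have hpos : (0 : ℝ) < n := by linarith
  set t : ℝ := 1 / n with ht
  have ht0 : 0 < t := by positivity
  have ht1 : t ≤ 1 / 2 := one_div_le_one_div_of_le (by norm_num) hn'
  have h := Real.abs_log_sub_add_sum_range_le (x := -t) (by rw [abs_neg, abs_of_pos ht0]; linarith) 2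
  rw [abs_neg, abs_of_pos ht0] at h
  simp only [Finset.sum_range_succ, Finset.sum_range_zero] at h
  have hb : t ^ (2 + 1) / (1 - t) ≤ 2 * t ^ 3 := by
    rw [div_le_iff₀ (by linarith)]
    have := mul_nonneg (pow_pos ht0 3).le (by linarith : (0 : ℝ) ≤ 1 - 2 * t)
    have e : 2 * t ^ 3 * (1 - t) - t ^ (2 + 1) = t ^ 3 * (1 - 2 * t) := by ring
    linarith
  have hb2 : 1 / 2 * t ^ 3 / (1 + t) ≤ 1 / 2 * t ^ 3 := div_le_self (by positivity) (by linarith)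
  have hb3 : 0 ≤ 1 / 2 * t ^ 3 / (1 + t) := by positivity
  have e : trapezoidError n = t - t ^ 2 / 2 - Real.log (1 + t) + 1 / 2 * t ^ 3 / (1 + t) := by
    rw [trapezoidError, show ((n : ℝ) + 1) / n = 1 + t by rw [ht]; field_simp]
    have : (n : ℝ) = 1 / t := by rw [ht]; field_simp
    rw [this]
    field_simp
    ring
  have e2 : 3 / (n : ℝ) ^ 3 = 3 * t ^ 3 := by rw [ht]; field_simp
  rw [e, e2]
  rw [abs_le] at h ⊢
  norm_num at h
  have ht3 := pow_pos ht0 3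
  constructor <;> linarith

theorem summable_mul_trapezoidError {a : ℕ → ℝ} {C : ℝ} (ha : ∀ n, |a n| ≤ C * n) :
    Summable fun n => a n * trapezoidError n := by
  have h := ((Real.summable_one_div_nat_pow (p := 2)).2 (by norm_num)).mul_left (3 * C)
  refine Summable.of_norm_bounded_eventually_nat h ?_
  filter_upwards [Filter.eventually_ge_atTop 2] with n hn
  have hn' : (0 : ℝ) < n := by exact_mod_cast (by omega : 0 < n)
  rw [norm_mul, Real.norm_eq_abs, Real.norm_eq_abs]
  calc |a n| * |trapezoidError n| ≤ C * n * (3 / (n : ℝ) ^ 3) :=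
        mul_le_mul (ha n) (abs_trapezoidError_le hn) (abs_nonneg _) ((abs_nonneg _).trans (ha n))
    _ = 3 * C * (1 / (n : ℝ) ^ 2) := by field_simp

/-- The interval [2k+1, 2k+2], scaled by 2, is split at 4k+3. -/
theorem odd_mul_trapezoidError (k : ℕ) :
    ((2 * k + 1 : ℕ) : ℝ) * trapezoidError (2 * k + 1) =
      1 / 2 * (((4 * k + 2 : ℕ) : ℝ) * trapezoidError (4 * k + 2)) +
      1 / 2 * (((4 * k + 3 : ℕ) : ℝ) * trapezoidError (4 * k + 3)) -
      1 / 2 * trapezoidError (4 * k + 3) +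
      1 / 2 * (1 / (4 * (k : ℝ) + 3) - 1 / (4 * (k : ℝ) + 4)) := by
  have hk : (0 : ℝ) ≤ k := k.cast_nonneg
  simp only [trapezoidError]
  push_cast
  rw [Real.log_div (by positivity) (by positivity), Real.log_div (by positivity) (by positivity),
    Real.log_div (by positivity) (by positivity),
    show (2 * (k : ℝ) + 1 + 1) = (4 * k + 3 + 1) / 2 by ring,
    show 2 * (k : ℝ) + 1 = (4 * k + 2) / 2 by ring,
    Real.log_div (by positivity) (by positivity), Real.log_div (by positivity) (by positivity),
    show 4 * (k : ℝ) + 2 + 1 = 4 * k + 3 by ring]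
  field_simp
  ring

/-- The logarithm over [4m+3, 4m+5] is split at 4m+4. -/
theorem cotIntegral_even (m : ℕ) :
    cotIntegral (2 * (m + 1)) =
      1 / 2 * (((4 * m + 4 : ℕ) : ℝ) * trapezoidError (4 * m + 4)) +
      1 / 2 * (((4 * m + 3 : ℕ) : ℝ) * trapezoidError (4 * m + 3)) +
      1 / 2 * trapezoidError (4 * m + 3) -
      1 / 4 * (1 / (4 * (m : ℝ) + 3) - 1 / (4 * (m : ℝ) + 5)) := by
  have hk : (0 : ℝ) ≤ m := m.cast_nonneg
  simp only [trapezoidError, cotIntegral]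
  push_cast
  rw [show 2 * (2 * ((m : ℝ) + 1)) + 1 = 4 * m + 5 by ring,
    show 2 * (2 * ((m : ℝ) + 1)) - 1 = 4 * m + 3 by ring,
    show 4 * (m : ℝ) + 4 + 1 = 4 * m + 5 by ring, show 4 * (m : ℝ) + 3 + 1 = 4 * m + 4 by ring,
    Real.log_div (by positivity) (by positivity), Real.log_div (by positivity) (by positivity),
    Real.log_div (by positivity) (by positivity)]
  field_simp
  ring

theorem summable_arith_prog {f : ℕ → ℝ} (hf : Summable f) {q : ℕ} (hq : q ≠ 0) (r : ℕ) :
    Summable fun m : ℕ => f (q * m + r) :=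
  hf.comp_injective fun a b hab => by simpa [hq] using hab

theorem HasSum.of_mod_four {f : ℕ → ℝ} {s₀ s₁ s₂ s₃ : ℝ} (h₀ : HasSum (fun m => f (4 * m)) s₀)
    (h₁ : HasSum (fun m => f (4 * m + 1)) s₁) (h₂ : HasSum (fun m => f (4 * m + 2)) s₂)
    (h₃ : HasSum (fun m => f (4 * m + 3)) s₃) : HasSum f ((s₀ + s₂) + (s₁ + s₃)) := by
  refine HasSum.even_add_odd (HasSum.even_add_odd ?_ ?_) (HasSum.even_add_odd ?_ ?_)
  · exact h₀.congr_fun fun m => by ring_nf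
  · exact h₂.congr_fun fun m => by ring_nf
  · exact h₁.congr_fun fun m => by ring_nf
  · exact h₃.congr_fun fun m => by ring_nf

/-! ### The base-free series -/

/-- The increment `c_n - c_{⌊n/B⌋}`, which does not depend on the base. -/
noncomputable def catalanIncrement (n : ℕ) : ℝ :=
  if Even n then (n : ℝ) / 2 else if n % 4 = 1 then -n else 0

theorem abs_catalanIncrement_le (n : ℕ) : |catalanIncrement n| ≤ n := by
  have hn : (0 : ℝ) ≤ n := n.cast_nonneg
  unfold catalanIncrement
  split_ifs
  · rw [abs_of_nonneg (by positivity)]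
    linarith
  · simp
  · simp

open Filter Topology Real in
theorem hasSum_catalanIncrement :
    HasSum (fun n => catalanIncrement n * trapezoidError n)
      (catalanConstant / π - 1 / 4 - 1 / 8 * log 2) := by
  have hA : Summable fun n : ℕ => (n : ℝ) * trapezoidError n :=
    summable_mul_trapezoidError (C := 1) fun n => by simp
  have hS : ∀ r, Summable fun m : ℕ => ((4 * m + r : ℕ) : ℝ) * trapezoidError (4 * m + r) :=
    fun r => summable_arith_prog hA (by norm_num) r
  obtain ⟨s₀, h₀⟩ := hS 0
  obtain ⟨s₁, h₁⟩ := hS 1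
  obtain ⟨s₂, h₂⟩ := hS 2
  obtain ⟨s₃, h₃⟩ := hS 3
  have hodd : HasSum (fun k : ℕ => ((2 * k + 1 : ℕ) : ℝ) * trapezoidError (2 * k + 1)) (s₁ + s₃) := by
    refine HasSum.even_add_odd ?_ ?_
    · exact h₁.congr_fun fun m => by rw [show 2 * (2 * m) + 1 = 4 * m + 1 by ring]
    · exact h₃.congr_fun fun m => by rw [show 2 * (2 * m + 1) + 1 = 4 * m + 3 by ring]
  have h₄ : HasSum (fun m : ℕ => ((4 * m + 4 : ℕ) : ℝ) * trapezoidError (4 * m + 4)) s₀ := by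
    refine (hasSum_nat_add_iff (f := fun m : ℕ => ((4 * m + 0 : ℕ) : ℝ) * trapezoidError (4 * m + 0))
      1).2 ?_
    simpa using h₀
  -- Subtracting all odd n from the class 3 mod 4 leaves minus the class 1 mod 4. In this
  -- arrangement each term is `cotIntegral (2 * (m + 1))` plus a rational term.
  have hV := (((h₄.mul_left (1 / 2)).add (h₂.mul_left (1 / 2))).add h₃).sub hodd
  have hlim := ((hasSum_catalanConstant_cotIntegral.tendsto_sum_nat.add
    tendsto_sum_cotIntegral).const_mul (1 / 2)).add (tendsto_sum_odd_reciprocals.const_mul (1 / 4))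
  have hval := tendsto_nhds_unique (hV.tendsto_sum_nat) (hlim.congr fun N => by
    rw [← Finset.sum_add_distrib, Finset.mul_sum, Finset.mul_sum, ← Finset.sum_add_distrib]
    refine Finset.sum_congr rfl fun m _ => ?_
    rw [sub_add_cancel, cotIntegral_even, odd_mul_trapezoidError]
    ring)
  have key : catalanConstant / π - 1 / 4 - 1 / 8 * log 2 =
      (1 / 2 * s₀ + 1 / 2 * s₂) + (-s₁ + 0) := by
    have : 1 / 2 * s₀ + 1 / 2 * s₂ + s₃ - (s₁ + s₃) = 1 / 2 * s₀ + 1 / 2 * s₂ + (-s₁ + 0) := by ring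
    rw [← this, hval]
    ring
  rw [key]
  refine HasSum.of_mod_four ?_ ?_ ?_ ?_
  · refine (h₀.mul_left (1 / 2)).congr_fun fun m => ?_
    rw [catalanIncrement, if_pos (by grind)]
    simp
    ring
  · refine h₁.neg.congr_fun fun m => ?_
    rw [catalanIncrement, if_neg (by grind), if_pos (by omega)]
    ring
  · refine (h₂.mul_left (1 / 2)).congr_fun fun m => ?_
    rw [catalanIncrement, if_pos (by grind)]
    ring
  · refine hasSum_zero.congr_fun fun m => ?_
    rw [catalanIncrement, if_neg (by grind), if_neg (by omega)]
    ring

/-! ### Growth and increments of the coefficients -/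

theorem catalanSeq_eq_add_increment (B : ℕ) (hB : 1 < B) {n : ℕ} (hn : n ≠ 0) :
    catalanSeq B hB n = catalanSeq B hB (n / B) + catalanIncrement n := by
  rcases Nat.even_or_odd' n with ⟨k, rfl | rfl⟩
  · rw [catalanSeq_even B hB k (by omega), catalanIncrement, if_pos (by simp)]
    push_cast
    ring
  · rw [catalanSeq_odd, catalanIncrement, if_neg (by simp)]
    rcases Nat.even_or_odd' k with ⟨j, rfl | rfl⟩
    · rw [if_pos (by omega), Odd.neg_one_zpow (by grind)]
      push_cast
      ring
    · rw [if_neg (by omega), Even.neg_one_zpow (by grind)]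
      ring

theorem abs_catalanSeq_le (B : ℕ) (hB : 1 < B) (n : ℕ) : |catalanSeq B hB n| ≤ 2 * n := by
  induction n using Nat.strong_induction_on with
  | _ n ih =>
    rcases eq_or_ne n 0 with rfl | hn
    · simp [catalanSeq_zero]
    · rw [catalanSeq_eq_add_increment B hB hn]
      have h1 := ih (n / B) (Nat.div_lt_self (Nat.pos_of_ne_zero hn) hB)
      have h2 : 2 * (n / B) ≤ n :=
        (Nat.mul_le_mul_right _ hB).trans (Nat.mul_div_le n B)
      have h3 : 2 * ((n / B : ℕ) : ℝ) ≤ n := by exact_mod_cast h2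
      have h4 := abs_catalanIncrement_le n
      have h5 := abs_add_le (catalanSeq B hB (n / B)) (catalanIncrement n)
      linarith

theorem baseLength_zero (B : ℕ) : baseLength B 0 = 0 := by simp [baseLength]

theorem baseLength_eq_add_one {B n : ℕ} (hB : 1 < B) (hn : n ≠ 0) :
    baseLength B n = baseLength B (n / B) + 1 := by
  rw [baseLength, Nat.digits_def' hB (Nat.pos_of_ne_zero hn), List.length_cons, baseLength]

theorem baseLength_le {B : ℕ} (hB : 1 < B) (n : ℕ) : baseLength B n ≤ n :=
  (Nat.digits_length_le_iff hB n).2 (Nat.lt_pow_self hB)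

/-- The coefficient of the series for `G / π`. -/
noncomputable def catalanCoeff (B : ℕ) (hB : 1 < B) (n : ℕ) : ℝ :=
  (1 / 8 : ℝ) * (baseLength B (n / 2) : ℝ) - (1 / 8 : ℝ) * (baseLength B n : ℝ) +
    catalanSeq B hB n

theorem catalanCoeff_zero (B : ℕ) (hB : 1 < B) : catalanCoeff B hB 0 = 0 := by
  simp [catalanCoeff, baseLength_zero, catalanSeq_zero]

theorem abs_catalanCoeff_le (B : ℕ) (hB : 1 < B) (n : ℕ) : |catalanCoeff B hB n| ≤ 3 * n := by
  have h1 : (baseLength B n : ℝ) ≤ n := by exact_mod_cast baseLength_le hB n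
  have h2 : (baseLength B (n / 2) : ℝ) ≤ n := by
    exact_mod_cast (baseLength_le hB _).trans (Nat.div_le_self n 2)
  have h3 := abs_le.1 (abs_catalanSeq_le B hB n)
  have h4 : (0 : ℝ) ≤ baseLength B n := Nat.cast_nonneg _
  have h5 : (0 : ℝ) ≤ baseLength B (n / 2) := Nat.cast_nonneg _
  rw [catalanCoeff, abs_le]
  constructor <;> linarith

/-- Halving commutes with floor division by B, so both digit lengths drop by one and cancel, except
at n = 1, where ⌊n/2⌋ = 0 has no digit to lose. -/
theorem catalanCoeff_sub (B : ℕ) (hB : 1 < B) (n : ℕ) :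
    catalanCoeff B hB n - catalanCoeff B hB (n / B) =
      catalanIncrement n - if n = 1 then 1 / 8 else 0 := by
  rcases eq_or_ne n 0 with rfl | hn
  · simp [catalanIncrement]
  · have hd : n / B / 2 = n / 2 / B := by rw [Nat.div_div_eq_div_mul, mul_comm, Nat.div_div_eq_div_mul]
    rw [catalanCoeff, catalanCoeff, catalanSeq_eq_add_increment B hB hn,
      baseLength_eq_add_one hB hn, hd]
    split_ifs with h1
    · subst h1
      simp [baseLength_zero]
      ring
    · rw [baseLength_eq_add_one hB (show n / 2 ≠ 0 by omega)]
      push_cast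
      ring

/-! ### Addison's ratio and regrouping -/

/-- With y = Bk, m(B−m)/(y(y+B)(y+m)) is the height at y+m of the chord of 1/x over [y, y+B] above
the curve. Summing over m gives the coarse trapezoidal value minus the fine one; the logarithms
cancel, and by scaling the coarse error is τ(k). -/
theorem addison_ratio_eq {B k : ℕ} (hB : 1 < B) (hk : 0 < k) :
    addisonP B k / addisonDenom B k =
      trapezoidError k - ∑ i ∈ Finset.range B, trapezoidError (B * k + i) := by
  have hB' : (0 : ℝ) < B := by exact_mod_cast (by omega : 0 < B)
  have hk' : (0 : ℝ) < k := by exact_mod_cast hk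
  obtain ⟨b, rfl⟩ : ∃ b, B = b + 1 := ⟨B - 1, by omega⟩
  have hIcc : ∀ f : ℕ → ℝ, ∏ j ∈ Finset.Icc 1 b, f j = ∏ j ∈ Finset.range b, f (j + 1) := by
    intro f
    rw [Finset.range_eq_Ico, Finset.prod_Ico_add' f 0 b 1]
    rfl
  have hIcc' : ∀ f : ℕ → ℝ, ∑ j ∈ Finset.Icc 1 b, f j = ∑ j ∈ Finset.range b, f (j + 1) := by
    intro f
    rw [Finset.range_eq_Ico, Finset.sum_Ico_add' f 0 b 1]
    rfl
  have hprod : (∏ j ∈ Finset.range b, (((b + 1 : ℕ) : ℝ) * k + ((j + 1 : ℕ) : ℝ))) ≠ 0 :=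
    Finset.prod_ne_zero_iff.2 fun j _ => by positivity
  have h1 : addisonP (b + 1) k / addisonDenom (b + 1) k =
      ∑ m ∈ Finset.range (b + 1), (m : ℝ) * (((b + 1 : ℕ) : ℝ) - m) / (((b + 1 : ℕ) : ℝ) * k + m) /
        (((b + 1 : ℕ) : ℝ) * k * (((b + 1 : ℕ) : ℝ) * k + ((b + 1 : ℕ) : ℝ))) := by
    rw [addisonP, addisonDenom, Nat.add_sub_cancel, hIcc, hIcc', Finset.prod_range_succ,
      Finset.prod_range_succ', ← Finset.sum_div, Finset.sum_range_succ']
    simp only [Nat.cast_zero, zero_mul, zero_div, add_zero]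
    generalize (∏ j ∈ Finset.range b, (((b + 1 : ℕ) : ℝ) * k + ((j + 1 : ℕ) : ℝ))) = p at hprod ⊢
    field_simp
  generalize b + 1 = B at *
  have hx : ∀ p : ℕ, (0 : ℝ) < (B : ℝ) * k + p := fun p => by positivity
  -- The upper limit p is freed from B to allow induction; the chord weights (B−m)/B and m/B sum to
  -- the two quadratics in p.
  have h2 : ∀ p : ℕ, ∑ m ∈ Finset.range p, ((m : ℝ) * ((B : ℝ) - m) / ((B : ℝ) * k + m) /
        ((B : ℝ) * k * ((B : ℝ) * k + B)) + trapezoidError (B * k + m)) =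
      1 / B * ((p * B - p * (p - 1) / 2) / (B * k) + p * (p - 1) / 2 / (B * k + B)) +
        1 / 2 * (1 / (B * k + p) - 1 / (B * k)) -
        (Real.log (B * k + p) - Real.log (B * k)) := by
    intro p
    induction p with
    | zero => simp
    | succ p ih =>
      have hp := hx p
      have hp1 : (0 : ℝ) < (B : ℝ) * k + p + 1 := by positivity
      rw [Finset.sum_range_succ, ih, trapezoidError]
      push_cast
      rw [← add_assoc, Real.log_div hp1.ne' hp.ne']
      field_simp
      ring_nf
  have h3 := h2 B
  rw [Finset.sum_add_distrib, ← h1] at h3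
  rw [eq_sub_iff_add_eq, h3, trapezoidError, show (B : ℝ) * k + B = B * (k + 1) by ring,
    Real.log_mul (by positivity) (by positivity), Real.log_mul (by positivity) (by positivity),
    Real.log_div (by positivity) (by positivity)]
  field_simp
  ring

theorem hasSum_div_mul_trapezoidError {B : ℕ} (hB : 1 < B) {a : ℕ → ℝ} {s : ℝ}
    (h : HasSum (fun n => a (n / B) * trapezoidError n) s) :
    HasSum (fun k => a k * ∑ i ∈ Finset.range B, trapezoidError (B * k + i)) s := by
  have : NeZero B := ⟨by omega⟩
  have h' := (Nat.divModEquiv B).symm.hasSum_iff.2 h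
  refine h'.prod_fiberwise fun k => ?_
  rw [Finset.mul_sum, ← Fin.sum_univ_eq_sum_range (fun i => a k * trapezoidError (B * k + i))]
  convert! hasSum_fintype (_ : Fin B → ℝ) using 1
  refine Finset.sum_congr rfl fun i _ => ?_
  have : (k * B + (i : ℕ)) / B = k := by
    rw [mul_comm, Nat.mul_add_div (by omega), Nat.div_eq_of_lt i.2, add_zero]
  simp [Nat.divModEquiv, this, mul_comm B k]

theorem hasSum_catalanCoeff_mul (B : ℕ) (hB : 1 < B) :
    HasSum (fun k => catalanCoeff B hB k * (addisonP B k / addisonDenom B k))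
      (catalanConstant / Real.pi - 11 / 32) := by
  obtain ⟨s, hs⟩ := summable_mul_trapezoidError (abs_catalanCoeff_le B hB)
  have hle : ∀ n, |catalanCoeff B hB (n / B)| ≤ 3 * n := fun n =>
    (abs_catalanCoeff_le B hB _).trans (by gcongr; exact Nat.div_le_self n B)
  obtain ⟨t, ht⟩ := summable_mul_trapezoidError hle
  have hone : HasSum (fun n => (if n = 1 then (1 / 8 : ℝ) else 0) * trapezoidError n)
      (1 / 8 * trapezoidError 1) := by
    simpa using hasSum_single (f := fun n => (if n = 1 then (1 / 8 : ℝ) else 0) * trapezoidError n) 1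
      (fun n hn => by simp [hn])
  -- As τ(1) = 3/4 − log 2, the correction −τ(1)/8 cancels the logarithm and turns 1/4 into 11/32.
  have hdiff : s - t = catalanConstant / Real.pi - 11 / 32 := by
    have h1 := hasSum_catalanIncrement.sub hone
    have h2 := h1.unique ((hs.sub ht).congr_fun fun n => by
      rw [← sub_mul, ← sub_mul, catalanCoeff_sub])
    rw [← h2, trapezoidError]
    norm_num
    ring
  rw [← hdiff]
  refine (hs.sub (hasSum_div_mul_trapezoidError (a := catalanCoeff B hB) hB ht)).congr_fun fun k => ?_
  rcases Nat.eq_zero_or_pos k with rfl | hk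
  · simp [catalanCoeff_zero]
  · rw [addison_ratio_eq hB hk, mul_sub]

theorem mainTheorem11 (B : ℕ) (hB : 1 < B) :
    Summable (fun i : ℕ =>
        ((1 / 8 : ℝ) * (baseLength B ((i + 1) / 2) : ℝ) - (1 / 8 : ℝ) * (baseLength B (i + 1) : ℝ)
            + catalanSeq B hB (i + 1))
          * (addisonP B ((i + 1 : ℕ) : ℝ) / addisonDenom B ((i + 1 : ℕ) : ℝ))) ∧
      catalanConstant / Real.pi = 11 / 32 +
        ∑' i : ℕ,
          ((1 / 8 : ℝ) * (baseLength B ((i + 1) / 2) : ℝ) - (1 / 8 : ℝ) * (baseLength B (i + 1) : ℝ)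
              + catalanSeq B hB (i + 1))
            * (addisonP B ((i + 1 : ℕ) : ℝ) / addisonDenom B ((i + 1 : ℕ) : ℝ)) := by
  have h := (hasSum_nat_add_iff' 1).2 (hasSum_catalanCoeff_mul B hB)
  simp only [Finset.sum_range_one, catalanCoeff_zero, zero_mul, sub_zero] at h
  simp only [catalanCoeff] at h
  exact ⟨h.summable, by rw [h.tsum_eq]; ring⟩
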